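/- Let $X$ be a connected topological space with exactly two path components, each of which is, in the subspace topology, simply connected and locally path-connected, and let $x_0, x_1$ be points in different path components of $X$. A \emph{bridge} joining two points of a space is an arc (a copy of $[0,1]$) glued to the space along its two endpoints, which are identified with the two given points; the resulting space carries the quotient topology. Let $X_2 = X \cup A \cup B$ be obtained from $X$ by adding two bridges $A$ and $B$, both joining $x_0$ and $x_1$. Let $\tilde X_2$ be obtained from $X \times \{0,1\}$ (where $\{0,1\}$ is discrete) by adding four bridges: $A_0$ joining $(x_0,0)$ and $(x_1,1)$, $A_1$ joining $(x_0,1)$ and $(x_1,0)$, $B_0$ joining $(x_0,0)$ and $(x_1,0)$, and $B_1$ joining $(x_0,1)$ and $(x_1,1)$. Let $p_1 : \tilde X_2 \to X_2$ be the natural extension of the projection $X \times \{0,1\} \to X$ which maps $A_0$ and $A_1$ homeomorphically onto $A$, and $B_0$ and $B_1$ homeomorphically onto $B$ (compatibly with the parametrizations by $[0,1]$ running from the point over $x_0$ to the point over $x_1$). Then, for all choices of base points, $\pi_1(X_2) \cong \mathbb{Z}$ and $\pi_1(\tilde X_2) \cong \mathbb{Z}$; and for every base point $e \in \tilde X_2$,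 the image of $\pi_1(p_1) : \pi_1(\tilde X_2, e) \to \pi_1(X_2, p_1(e))$ corresponds to $2\mathbb{Z}$ under every isomorphism $\pi_1(X_2, p_1(e)) \cong \mathbb{Z}$. -/

import Mathlib

namespace AnomalousCover

section Bridges

variable {Y Y' J J' : Type*}

/-- The gluing relation: the initial point of the `j`-th arc is identified with `s j`,
its terminal point with `t j`. -/
inductive BridgeRel (s t : J → Y) : Y ⊕ (Σ _ : J, unitInterval) → Y ⊕ (Σ _ : J, unitInterval) → Prop
  | initial (j : J) : BridgeRel s t (Sum.inr ⟨j, 0⟩) (Sum.inl (s j))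
  | terminal (j : J) : BridgeRel s t (Sum.inr ⟨j, 1⟩) (Sum.inl (t j))

/-- The space obtained from `Y` by adding, for every `j : J`, a bridge (an arc whose interior is
disjoint from `Y` and from the other bridges) joining `s j` to `t j`. -/
def Bridged (s t : J → Y) := Quot (BridgeRel s t)

/-- The quotient topology of the disjoint union of `Y` and `J` many copies of `[0, 1]`. -/
instance [TopologicalSpace Y] (s t : J → Y) : TopologicalSpace (Bridged s t) :=
  inferInstanceAs (TopologicalSpace (Quot (BridgeRel s t)))

/-- The inclusion of `Y`. -/
def Bridged.incl (s t : J → Y) (y : Y) : Bridged s t := Quot.mk _ (Sum.inl y)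

/-- The `j`-th bridge, parametrized by `[0, 1]`. -/
def Bridged.arc (s t : J → Y) (j : J) (r : unitInterval) : Bridged s t := Quot.mk _ (Sum.inr ⟨j, r⟩)

/-- The extension of a continuous map `f : Y → Y'` that sends the `j`-th bridge
homeomorphically (by the identity of `[0, 1]`) onto the bridge with index `g j`. -/
def Bridged.map [TopologicalSpace Y] [TopologicalSpace Y'] {s t : J → Y} {s' t' : J' → Y'}
    (f : C(Y, Y')) (g : J → J') (hs : ∀ j, f (s j) = s' (g j)) (ht : ∀ j, f (t j) = t' (g j)) :
    C(Bridged s t, Bridged s' t') where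
  toFun := Quot.lift
    (Sum.elim (fun y => Bridged.incl s' t' (f y)) (fun q => Bridged.arc s' t' (g q.1) q.2)) <| by
      rintro _ _ (j | j)
      · exact (Quot.sound (BridgeRel.initial (g j))).trans (congrArg (Bridged.incl s' t') (hs j).symm)
      · exact (Quot.sound (BridgeRel.terminal (g j))).trans (congrArg (Bridged.incl s' t') (ht j).symm)
  continuous_toFun := by
    refine continuous_quot_lift _ (Continuous.sumElim ?_ ?_)
    · exact continuous_quot_mk.comp (continuous_inl.comp f.continuous)
    · refine continuous_sigma fun j => ?_
      exact continuous_quot_mk.comp (continuous_inr.comp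
        (continuous_sigmaMk (σ := fun _ : J' => unitInterval) (i := g j)))

end Bridges

/-- Labels of the bridges of the base space. -/
inductive BaseBridge
  | A
  | B

/-- Labels of the bridges of the covering space. -/
inductive CoverBridge
  | A₀
  | A₁
  | B₀
  | B₁

/-- `A₀` and `A₁` lie over `A`; `B₀` and `B₁` lie over `B`. -/
def CoverBridge.proj : CoverBridge → BaseBridge
  | A₀ => .A
  | A₁ => .A
  | B₀ => .B
  | B₁ => .B

section Spaces

variable {X : Type*}

/-- Initial points of the bridges of the covering space. -/
def coverStart (x₀ : X) : CoverBridge → X × Fin 2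
  | .A₀ => (x₀, 0)
  | .A₁ => (x₀, 1)
  | .B₀ => (x₀, 0)
  | .B₁ => (x₀, 1)

/-- Terminal points of the bridges of the covering space. -/
def coverEnd (x₁ : X) : CoverBridge → X × Fin 2
  | .A₀ => (x₁, 1)
  | .A₁ => (x₁, 0)
  | .B₀ => (x₁, 0)
  | .B₁ => (x₁, 1)

/-- `X₂ = X ∪ A ∪ B`, where `A` and `B` are bridges joining `x₀` and `x₁`. -/
abbrev X2 (x₀ x₁ : X) :=
  Bridged (fun _ : BaseBridge => x₀) (fun _ : BaseBridge => x₁)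

/-- The space `X × {0, 1}` with the four bridges `A₀, A₁, B₀, B₁` added. -/
abbrev X2Cover (x₀ x₁ : X) :=
  Bridged (coverStart x₀) (coverEnd x₁)

/-- The projection `p₁`, extending `X × {0, 1} → X` and sending `A₀, A₁` onto `A` and
`B₀, B₁` onto `B`. -/
def p1 [TopologicalSpace X] (x₀ x₁ : X) : C(X2Cover x₀ x₁, X2 x₀ x₁) :=
  Bridged.map ContinuousMap.fst CoverBridge.proj
    (fun j => by cases j <;> rfl) (fun j => by cases j <;> rfl)

end Spaces

end AnomalousCover

/-! Each path component of `X` is simply connected, so paths in `X` with the same end points are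
homotopic. As far as paths are concerned, `X` is two points, `X2` is a cycle with two edges A and B,
and `X2Cover` is a cycle with four edges wrapping twice around it. The argument makes this precise
inside the fundamental groupoid.

Upper bound: `Bridged.path_induction` generates the groupoid of a bridged space by paths in the
original space and paths along bridges. Path classes from a base point to representatives of the
path components, running along a spanning tree of bridges, extend compatibly to all points
(`exists_compatible_classes`). Relative to them only the bridge outside the tree contributes, so
every fundamental group is cyclic (`Bridged.exists_forall_mem_zpowers_conj`).

Lower bound: mapping A once around the circle and everything else to a point gives an additive
winding number. It is 1 on the generator below and 2 on the generator above, measured after `p1`. So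
both groups are infinite cyclic, and the upper generator maps to the square of the lower one. -/

namespace AnomalousCover

open Set Topology unitInterval CategoryTheory

namespace Bridged

/-! ### Points of a bridged space -/

section Points

variable {Y J : Type*} {s t : J → Y}

theorem arc_zero (j : J) : arc s t j 0 = incl s t (s j) := Quot.sound (.initial j)

theorem arc_one (j : J) : arc s t j 1 = incl s t (t j) := Quot.sound (.terminal j)

theorem forall_of_incl_of_arc {p : Bridged s t → Prop} (hincl : ∀ y, p (incl s t y))
    (harc : ∀ j r, p (arc s t j r)) (z : Bridged s t) : p z := by
  induction z using Quot.ind with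
  | mk z =>
    rcases z with y | ⟨j, r⟩
    · exact hincl y
    · exact harc j r

/-- A function on a bridged space, given by a function on the original space and functions on
the bridges that agree at the end points. -/
def desc {Z : Type*} (f : Y → Z) (g : J → I → Z) (h₀ : ∀ j, g j 0 = f (s j))
    (h₁ : ∀ j, g j 1 = f (t j)) : Bridged s t → Z :=
  Quot.lift (Sum.elim f fun q => g q.1 q.2) <| by
    rintro _ _ (j | j)
    · exact h₀ j
    · exact h₁ j

/-- The label and the parameter of a point in the interior of a bridge. -/
noncomputable def interiorCoord : Bridged s t → Option (J × I) :=
  haveI := Classical.propDecidable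
  desc (fun _ => none) (fun j r => if r = 0 ∨ r = 1 then none else some (j, r))
    (fun j => by simp) (fun j => by simp)

theorem interiorCoord_incl (y : Y) : interiorCoord (incl s t y) = none := rfl

theorem interiorCoord_arc (j : J) {r : I} (h : r ∈ Ioo 0 1) :
    interiorCoord (arc s t j r) = some (j, r) :=
  if_neg (by rintro (rfl | rfl) <;> simp at h)

/-- A set-theoretic left inverse exists: ends of bridges go to their attaching points and interior
points to `none`. Its discontinuity is harmless. -/
theorem incl_injective : Function.Injective (incl s t) := by
  intro y y' h
  let f : Bridged s t → Option Y := desc some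
    (fun j r => haveI := Classical.propDecidable
      if r = 0 then some (s j) else if r = 1 then some (t j) else none)
    (fun j => by simp) (fun j => by simp)
  exact Option.some_injective _ (congrArg f h)

theorem arc_ne_incl (j : J) {r : I} (h : r ∈ Ioo 0 1) (y : Y) : arc s t j r ≠ incl s t y := by
  intro e
  have := congrArg interiorCoord e
  rw [interiorCoord_arc j h, interiorCoord_incl] at this
  simp at this

theorem arc_injOn {j j' : J} {r r' : I} (h : r ∈ Ioo 0 1) (h' : r' ∈ Ioo 0 1)
    (e : arc s t j r = arc s t j' r') : j = j' ∧ r = r' := by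
  have := congrArg interiorCoord e
  rw [interiorCoord_arc j h, interiorCoord_arc j' h'] at this
  simpa using this

/-- The complement of the closed middle thirds of the bridges. -/
def outer (s t : J → Y) : Set (Bridged s t) :=
  desc (fun _ => True) (fun _ r => (r : ℝ) < 1 / 3 ∨ (2 / 3 : ℝ) < r)
    (fun j => by norm_num) (fun j => by norm_num)

theorem mem_outer_or (z : Bridged s t) : z ∈ outer s t ∨ ∃ j, z ∈ arc s t j '' Ioo 0 1 := by
  refine forall_of_incl_of_arc (p := fun z => z ∈ outer s t ∨ ∃ j, z ∈ arc s t j '' Ioo 0 1)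
    (fun y => Or.inl trivial) (fun j r => ?_) z
  by_cases hr : (r : ℝ) < 1 / 3 ∨ (2 / 3 : ℝ) < r
  · exact Or.inl hr
  · push Not at hr
    refine Or.inr ⟨j, r, ⟨?_, ?_⟩, rfl⟩
    · rw [← Subtype.coe_lt_coe]; push_cast; linarith
    · rw [← Subtype.coe_lt_coe]; push_cast; linarith

end Points

/-! ### The quotient topology near the original space and inside the bridges -/

section Topology

variable {Y J : Type*} [TopologicalSpace Y] {s t : J → Y}

theorem continuous_incl : Continuous (incl s t) := continuous_quot_mk.comp continuous_inl

theorem continuous_arc (j : J) : Continuous (arc s t j) := by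
  have h := @continuous_sigmaMk J (fun _ => I) _ j
  exact continuous_quot_mk.comp (continuous_inr.comp h)

theorem continuous_desc {Z : Type*} [TopologicalSpace Z] {f : Y → Z} {g : J → I → Z}
    {h₀ : ∀ j, g j 0 = f (s j)} {h₁ : ∀ j, g j 1 = f (t j)} (hf : Continuous f)
    (hg : ∀ j, Continuous (g j)) : Continuous (desc f g h₀ h₁ : Bridged s t → Z) :=
  continuous_quot_lift _ (hf.sumElim (continuous_sigma hg))

theorem isOpen_iff {U : Set (Bridged s t)} :
    IsOpen U ↔ IsOpen (incl s t ⁻¹' U) ∧ ∀ j, IsOpen (arc s t j ⁻¹' U) := by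
  refine (isQuotientMap_quot_mk.isOpen_preimage).symm.trans ?_
  rw [isOpen_sum_iff, isOpen_sigma_iff]
  rfl

theorem isInducing_incl : IsInducing (incl s t) := by
  refine isInducing_iff_nhds.2 fun y => le_antisymm continuous_incl.continuousAt.le_comap ?_
  intro W hW
  obtain ⟨W', hW', hW'o, hy⟩ := mem_nhds_iff.1 hW
  -- `W'` is thickened by the open half of each bridge adjacent to an end lying in `W'`; the two
  -- halves are disjoint, so the trace on `Y` is exactly `W'`.
  let U : Set (Bridged s t) := desc (fun y => y ∈ W')
    (fun j r => ((r : ℝ) < 1 / 2 ∧ s j ∈ W') ∨ ((1 / 2 : ℝ) < r ∧ t j ∈ W'))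
    (fun j => by norm_num) (fun j => by norm_num)
  have hU : IsOpen U := by
    refine isOpen_iff.2 ⟨hW'o, fun j => ?_⟩
    refine IsOpen.union (IsOpen.and ?_ (isOpen_const (p := s j ∈ W')))
      (IsOpen.and ?_ (isOpen_const (p := t j ∈ W')))
    · exact isOpen_lt continuous_subtype_val continuous_const
    · exact isOpen_lt continuous_const continuous_subtype_val
  exact ⟨U, hU.mem_nhds hy, fun z hz => hW' hz⟩

theorem isOpen_arc_image (j : J) {W : Set I} (hW : IsOpen W) (hW' : W ⊆ Ioo 0 1) :
    IsOpen (arc s t j '' W) := by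
  refine isOpen_iff.2 ⟨?_, fun j' => ?_⟩
  · convert! isOpen_empty
    refine eq_empty_of_forall_notMem ?_
    rintro y ⟨r, hr, e⟩
    exact arc_ne_incl j (hW' hr) y e
  · by_cases hj : j' = j
    · subst hj
      convert hW
      refine Subset.antisymm ?_ (subset_preimage_image _ _)
      rintro r' ⟨r, hr, e⟩
      by_cases h0 : r' = 0
      · subst h0
        exact (arc_ne_incl _ (hW' hr) _ (e.trans (arc_zero _))).elim
      by_cases h1 : r' = 1
      · subst h1
        exact (arc_ne_incl _ (hW' hr) _ (e.trans (arc_one _))).elim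
      have hr' : r' ∈ Ioo (0 : I) 1 :=
        ⟨unitInterval.pos_iff_ne_zero.2 h0, unitInterval.lt_one_iff_ne_one.2 h1⟩
      rwa [← (arc_injOn (hW' hr) hr' e).2]
    · convert! isOpen_empty
      refine eq_empty_of_forall_notMem ?_
      rintro r' ⟨r, hr, e⟩
      by_cases h0 : r' = 0
      · subst h0
        exact (arc_ne_incl _ (hW' hr) _ (e.trans (arc_zero _))).elim
      by_cases h1 : r' = 1
      · subst h1
        exact (arc_ne_incl _ (hW' hr) _ (e.trans (arc_one _))).elim
      have hr' : r' ∈ Ioo (0 : I) 1 :=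
        ⟨unitInterval.pos_iff_ne_zero.2 h0, unitInterval.lt_one_iff_ne_one.2 h1⟩
      exact hj (arc_injOn (hW' hr) hr' e).1.symm

/-- The ends are excluded because a bridge with `s j = t j` is a loop, on which the parameter is not
injective. -/
theorem isInducing_arc_restrict (j : J) :
    IsInducing (fun r : Ioo (0 : I) 1 => arc s t j r) := by
  refine isInducing_iff_nhds.2 fun r =>
    le_antisymm ((continuous_arc j).comp continuous_subtype_val).continuousAt.le_comap ?_
  intro W hW
  obtain ⟨W', hW', hW'o, hr⟩ := mem_nhds_iff.1 hW
  refine ⟨arc s t j '' (Subtype.val '' W'), (isOpen_arc_image j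
    (isOpen_Ioo.isOpenMap_subtype_val _ hW'o) ?_).mem_nhds ?_, ?_⟩
  · rintro _ ⟨u, -, rfl⟩
    exact u.2
  · exact mem_image_of_mem _ (mem_image_of_mem _ hr)
  · rintro u ⟨_, ⟨v, hv, rfl⟩, e⟩
    have := Subtype.ext (arc_injOn v.2 u.2 e).2
    exact hW' (this ▸ hv)

end Topology

/-! ### Pushing the ends of the bridges into the original space -/

section Stretch

/-- The map of the unit interval that collapses the first and the last third. -/
noncomputable def stretch (r : I) : I := projIcc 0 1 zero_le_one (3 * (r : ℝ) - 1)

theorem continuous_stretch : Continuous stretch := by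
  unfold stretch
  fun_prop

theorem stretch_of_lt {r : I} (h : (r : ℝ) < 1 / 3) : stretch r = 0 :=
  projIcc_of_le_left _ (by linarith)

theorem stretch_of_gt {r : I} (h : (2 / 3 : ℝ) < r) : stretch r = 1 :=
  projIcc_of_right_le _ (by linarith)

theorem stretch_zero : stretch 0 = 0 := stretch_of_lt (by norm_num)

theorem stretch_one : stretch 1 = 1 := stretch_of_gt (by norm_num)

variable {Y J : Type*} [TopologicalSpace Y] {s t : J → Y}

/-- The tracks of the homotopy that stretches the middle third of every bridge over the whole
bridge. -/
noncomputable def stretchTrack : Bridged s t → C(I, Bridged s t) :=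
  desc (fun y => ContinuousMap.const I (incl s t y))
    (fun j r => ⟨fun u => arc s t j (Icc.convexComb r (stretch r) u),
      (continuous_arc j).comp (Icc.continuous_convexComb _ _)⟩)
    (fun j => by ext u; simp [stretch_zero, arc_zero])
    (fun j => by ext u; simp [stretch_one, arc_one])

/-- With values in a path space, continuity is checked on the pieces of the quotient; no product of
a quotient map with the interval is involved. -/
theorem continuous_stretchTrack : Continuous (stretchTrack : Bridged s t → C(I, Bridged s t)) := by
  refine continuous_desc ?_ fun j => ?_
  · exact ContinuousMap.continuous_const'.comp continuous_incl
  · refine ContinuousMap.continuous_of_continuous_uncurry _ ?_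
    refine (continuous_arc j).comp ?_
    have h := continuous_stretch
    exact Icc.continuous_convexComb_prod.comp
      (continuous_fst.prodMk ((h.comp continuous_fst).prodMk continuous_snd))

theorem stretchTrack_arc (j : J) (r u : I) :
    stretchTrack (arc s t j r) u = arc s t j (Icc.convexComb r (stretch r) u) := rfl

/-- The final map of the stretching homotopy. -/
noncomputable def stretchMap : C(Bridged s t, Bridged s t) :=
  ⟨fun z => stretchTrack z 1, (ContinuousEvalConst.continuous_eval_const 1).comp
    continuous_stretchTrack⟩

/-- The homotopy that stretches the middle third of every bridge over the whole bridge. -/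
noncomputable def stretchHomotopy :
    (ContinuousMap.id (Bridged s t)).Homotopy stretchMap where
  toFun q := stretchTrack q.2 q.1
  continuous_toFun := (continuous_stretchTrack.comp continuous_snd).eval continuous_fst
  map_zero_left := by
    refine forall_of_incl_of_arc (fun y => rfl) fun j r => ?_
    simp [stretchTrack_arc]
  map_one_left _ := rfl

theorem isOpen_outer : IsOpen (outer s t) := by
  refine isOpen_iff.2 ⟨isOpen_univ, fun j => IsOpen.union ?_ ?_⟩
  · exact isOpen_lt continuous_subtype_val continuous_const
  · exact isOpen_lt continuous_const continuous_subtype_val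

/-- The thirds of a bridge that lie in `outer` are those that `stretch` collapses to the ends. -/
theorem stretchMap_mem_range_incl {z : Bridged s t} (hz : z ∈ outer s t) :
    stretchMap z ∈ range (incl s t) := by
  revert hz
  refine forall_of_incl_of_arc
    (p := fun z : Bridged s t => z ∈ outer s t → stretchMap z ∈ range (incl s t))
    (fun y _ => ⟨y, rfl⟩) (fun j r hr => ?_) z
  change stretchTrack (arc s t j r) 1 ∈ range (incl s t)
  rw [stretchTrack_arc, Icc.convexComb_one]
  rcases hr with hr | hr
  · exact ⟨s j, by rw [stretch_of_lt hr, arc_zero]⟩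
  · exact ⟨t j, by rw [stretch_of_gt hr, arc_one]⟩

end Stretch

/-! ### Generators of the fundamental groupoid -/

section Generation

variable {Y J : Type*} [TopologicalSpace Y] {s t : J → Y}

/-- Lifted paths have end points that agree with the given ones only propositionally; this
transports `P` without casts. -/
theorem prop_of_forall_apply_eq {Z : Type*} [TopologicalSpace Z]
    {P : ∀ {a b : Z}, Path.Homotopic.Quotient a b → Prop} {a b a' b' : Z} {w : Path a b}
    (w' : Path a' b') (h : ∀ u, w u = w' u) (hw' : P (Path.Homotopic.Quotient.mk w')) :
    P (Path.Homotopic.Quotient.mk w) := by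
  obtain rfl : a = a' := by simpa using h 0
  obtain rfl : b = b' := by simpa using h 1
  obtain rfl : w = w' := by ext u; exact h u
  exact hw'

/-- The fundamental groupoid of a bridged space is generated by the paths in the original space
and the paths along the bridges. -/
theorem path_induction {P : ∀ {a b : Bridged s t}, Path.Homotopic.Quotient a b → Prop}
    (htrans : ∀ {a b c : Bridged s t} (p : Path.Homotopic.Quotient a b)
      (q : Path.Homotopic.Quotient b c), P p → P q → P (p.trans q))
    (hsymm : ∀ {a b : Bridged s t} (p : Path.Homotopic.Quotient a b), P p → P p.symm)
    (hincl : ∀ {y y' : Y} (p : Path y y'),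
      P (Path.Homotopic.Quotient.mk (p.map (continuous_incl (s := s) (t := t)))))
    (harc : ∀ (j : J) {r r' : I} (p : Path r r'),
      P (Path.Homotopic.Quotient.mk (p.map (continuous_arc (s := s) (t := t) j))))
    {a b : Bridged s t} (q : Path.Homotopic.Quotient a b) : P q := by
  have hincl' : ∀ {a b : Bridged s t} (w : Path a b), (∀ u, w u ∈ range (incl s t)) →
      P (Path.Homotopic.Quotient.mk w) := by
    intro a b w hw
    choose v hv using hw
    have hvc : Continuous v := by
      rw [isInducing_incl (s := s) (t := t) |>.continuous_iff]
      convert w.continuous using 1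
      exact funext hv
    let p : Path (v 0) (v 1) := ⟨⟨v, hvc⟩, rfl, rfl⟩
    exact prop_of_forall_apply_eq (P := P) _ (fun u => (hv u).symm) (hincl p)
  have harc' : ∀ {a b : Bridged s t} (w : Path a b) (j : J),
      (∀ u, w u ∈ arc s t j '' Ioo 0 1) → P (Path.Homotopic.Quotient.mk w) := by
    intro a b w j hw
    choose v hv hv' using hw
    have hvc : Continuous v := by
      refine continuous_subtype_val.comp (f := fun u => (⟨v u, hv u⟩ : Ioo (0 : I) 1)) ?_
      rw [isInducing_arc_restrict (s := s) (t := t) j |>.continuous_iff]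
      convert w.continuous using 1
      exact funext hv'
    let p : Path (v 0) (v 1) := ⟨⟨v, hvc⟩, rfl, rfl⟩
    exact prop_of_forall_apply_eq (P := P) _ (fun u => (hv' u).symm) (harc j p)
  have htrack : ∀ a : Bridged s t, P (Path.Homotopic.Quotient.mk (stretchHomotopy.evalAt a)) := by
    refine forall_of_incl_of_arc (fun y => ?_) fun j r => ?_
    · exact hincl (Path.refl y)
    · let p : Path r (stretch r) := ⟨⟨_, Icc.continuous_convexComb r (stretch r)⟩, by simp, by simp⟩
      exact prop_of_forall_apply_eq (P := P) (p.map (continuous_arc j)) (fun u => rfl) (harc j p)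
  -- The stretching homotopy replaces `w` by a path in the original space, conjugated by two tracks,
  -- each constant or running along a bridge.
  have houter : ∀ {a b : Bridged s t} (w : Path a b), (∀ u, w u ∈ outer s t) →
      P (Path.Homotopic.Quotient.mk w) := by
    intro a b w hw
    have h := Path.Homotopic.Quotient.eq.2
      (Path.Homotopic.map_trans_evalAt (stretchHomotopy (s := s) (t := t)) w)
    have e : (Path.Homotopic.Quotient.mk w : Path.Homotopic.Quotient a b) =
        ((Path.Homotopic.Quotient.mk (stretchHomotopy.evalAt a)).trans
          (Path.Homotopic.Quotient.mk (w.map stretchMap.continuous))).trans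
          (Path.Homotopic.Quotient.mk (stretchHomotopy.evalAt b)).symm := by
      rw [← Path.Homotopic.Quotient.mk_trans, ← h, Path.Homotopic.Quotient.mk_trans,
        Path.Homotopic.Quotient.trans_assoc,
        Path.Homotopic.Quotient.trans_symm, Path.Homotopic.Quotient.trans_refl]
      rfl
    rw [e]
    refine htrans _ _ (htrans _ _ (htrack a) (hincl' _ fun u => ?_)) (hsymm _ (htrack b))
    exact stretchMap_mem_range_incl (hw u)
  induction q using Path.Homotopic.Quotient.ind with
  | mk w =>
    -- A Lebesgue subdivision puts each piece of `w` in `outer` or in one open bridge.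
    let c : Option J → Set I := fun o => w ⁻¹' (o.elim (outer s t) fun j => arc s t j '' Ioo 0 1)
    have hc₁ : ∀ o, IsOpen (c o) := by
      rintro (_ | j)
      · exact isOpen_outer.preimage w.continuous
      · exact (isOpen_arc_image j isOpen_Ioo subset_rfl).preimage w.continuous
    have hc₂ : univ ⊆ ⋃ o, c o := by
      intro u _
      rcases mem_outer_or (w u) with h | ⟨j, h⟩
      · exact mem_iUnion.2 ⟨none, h⟩
      · exact mem_iUnion.2 ⟨some j, h⟩
    obtain ⟨d, hd0, hdm, ⟨n, hn⟩, hd⟩ :=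
      exists_monotone_Icc_subset_open_cover_unitInterval hc₁ hc₂
    have hsub : ∀ m, P (Path.Homotopic.Quotient.mk (w.subpath (d m) (d (m + 1)))) := by
      intro m
      obtain ⟨o, ho⟩ := hd m
      have hmem : ∀ u, w.subpath (d m) (d (m + 1)) u ∈
          (o.elim (outer s t) fun j => arc s t j '' Ioo 0 1) := by
        intro u
        have : w.subpath (d m) (d (m + 1)) u ∈ w '' Icc (d m) (d (m + 1)) := by
          rw [← Path.range_subpath_of_le _ _ _ (hdm m.le_succ)]
          exact mem_range_self u
        obtain ⟨x, hx, e⟩ := this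
        rw [← e]
        exact ho hx
      rcases o with _ | j
      · exact houter _ hmem
      · exact harc' _ j hmem
    have hall : ∀ m, P (Path.Homotopic.Quotient.mk (w.subpath (d 0) (d m))) := by
      intro m
      induction m with
      | zero =>
        -- Constant classes are not among the assumptions on `P`; they arise as a class times its
        -- inverse.
        have := htrans _ _ (hsub 0) (hsymm _ (hsub 0))
        rwa [Path.Homotopic.Quotient.trans_symm, ← Path.Homotopic.Quotient.mk_refl,
          ← Path.subpath_self] at this
      | succ m ih =>
        have := htrans _ _ ih (hsub m)
        rwa [← Path.Homotopic.Quotient.mk_trans,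
          Path.Homotopic.Quotient.eq.2
            ⟨Path.Homotopy.subpathTransSubpath w (d 0) (d m) (d (m + 1))⟩] at this
    have := hall n
    rw [hd0, hn n le_rfl, Path.subpath_zero_one] at this
    exact prop_of_forall_apply_eq (P := P) (w.cast w.source w.target) (fun u => rfl) this

end Generation

end Bridged

instance simplyConnectedSpace_unitInterval : SimplyConnectedSpace I :=
  haveI : ContractibleSpace I := (convex_Icc (0 : ℝ) 1).contractibleSpace ⟨0, by simp⟩
  inferInstance

/-! ### Cyclic fundamental groups of bridged spaces -/

namespace Bridged

variable {Y J : Type*} [TopologicalSpace Y] {s t : J → Y}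

/-- The path along a bridge from its initial point to the point with parameter `r`. -/
noncomputable def arcTo (s t : J → Y) (j : J) (r : I) : Path (incl s t (s j)) (arc s t j r) where
  toFun u := arc s t j (Icc.convexComb 0 r u)
  continuous_toFun := (continuous_arc j).comp (Icc.continuous_convexComb _ _)
  source' := by simp [arc_zero]
  target' := by simp

/-- The path along a bridge. -/
def arcPath (s t : J → Y) (j : J) : Path (incl s t (s j)) (incl s t (t j)) where
  toFun u := arc s t j u
  continuous_toFun := continuous_arc j
  source' := arc_zero j
  target' := arc_one j

/-- Both sides are images of paths in the interval with the same ends, and the interval is simply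
connected. -/
theorem mk_map_arc (j : J) {r r' : I} (p : Path r r') :
    Path.Homotopic.Quotient.mk (p.map (continuous_arc (s := s) (t := t) j)) =
      (Path.Homotopic.Quotient.mk (arcTo s t j r)).symm.trans
        (Path.Homotopic.Quotient.mk (arcTo s t j r')) := by
  have hseg : ∀ r : I, ∃ e : Path 0 r, ∀ u, arcTo s t j r u = arc s t j (e u) := fun r =>
    ⟨⟨⟨_, Icc.continuous_convexComb 0 r⟩, by simp, by simp⟩, fun u => rfl⟩
  obtain ⟨e, he⟩ := hseg r
  obtain ⟨e', he'⟩ := hseg r'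
  have h : (arcTo s t j r).symm.trans (arcTo s t j r') =
      (e.symm.trans e').map (continuous_arc (s := s) (t := t) j) := by
    ext u
    simp only [Path.trans_apply, Path.map_coe, Function.comp_apply, Path.symm_apply, he, he']
    split_ifs <;> rfl
  rw [← Path.Homotopic.Quotient.mk_symm, ← Path.Homotopic.Quotient.mk_trans, h]
  exact Path.Homotopic.Quotient.eq.2
    ((SimplyConnectedSpace.paths_homotopic p (e.symm.trans e')).map ⟨_, continuous_arc j⟩)

/-- A choice of path classes from a base point to the points of the original space extends to
a choice of path classes to all points, following the bridges from their initial points. -/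
theorem exists_extend_classes {z₀ : Bridged s t}
    (T : ∀ y, Path.Homotopic.Quotient z₀ (incl s t y)) :
    ∃ C : ∀ z, Path.Homotopic.Quotient z₀ z, (∀ y, C (incl s t y) = T y) ∧
      ∀ j, ∀ r ∈ Ioo (0 : I) 1, C (arc s t j r) =
        (T (s j)).trans (Path.Homotopic.Quotient.mk (arcTo s t j r)) := by
  -- Quantifying over all names of `z` makes the choice independent of representatives; ends of
  -- bridges count as points of the original space.
  have h : ∀ z : Bridged s t, ∃ c : Path.Homotopic.Quotient z₀ z,
      (∀ y (e : z = incl s t y), c = (T y).cast rfl e) ∧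
      ∀ j, ∀ r ∈ Ioo (0 : I) 1, ∀ e : z = arc s t j r, c =
        ((T (s j)).trans (Path.Homotopic.Quotient.mk (arcTo s t j r))).cast rfl e := by
    have h₁ : ∀ y : Y, ∃ c : Path.Homotopic.Quotient z₀ (incl s t y),
      (∀ y' (e : incl s t y = incl s t y'), c = (T y').cast rfl e) ∧
      ∀ j, ∀ r ∈ Ioo (0 : I) 1, ∀ e : incl s t y = arc s t j r, c =
        ((T (s j)).trans (Path.Homotopic.Quotient.mk (arcTo s t j r))).cast rfl e := by
      refine fun y => ⟨T y, fun y' e => ?_, fun j r hr e => (arc_ne_incl j hr y e.symm).elim⟩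
      obtain rfl := incl_injective e
      rw [Path.Homotopic.Quotient.cast_rfl_rfl]
    refine forall_of_incl_of_arc h₁ fun j r => ?_
    by_cases h0 : r = 0
    · rw [h0, arc_zero]
      exact h₁ _
    by_cases h1 : r = 1
    · rw [h1, arc_one]
      exact h₁ _
    have hr : r ∈ Ioo (0 : I) 1 :=
      ⟨unitInterval.pos_iff_ne_zero.2 h0, unitInterval.lt_one_iff_ne_one.2 h1⟩
    refine ⟨(T (s j)).trans (Path.Homotopic.Quotient.mk (arcTo s t j r)),
      fun y e => (arc_ne_incl j hr y e).elim, fun j' r' hr' e => ?_⟩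
    obtain ⟨rfl, rfl⟩ := arc_injOn hr hr' e
    rw [Path.Homotopic.Quotient.cast_rfl_rfl]
  choose C hC hC' using h
  exact ⟨C, fun y => by rw [hC _ y rfl, Path.Homotopic.Quotient.cast_rfl_rfl],
    fun j r hr => by rw [hC' _ j r hr rfl, Path.Homotopic.Quotient.cast_rfl_rfl]⟩

/-- If, with respect to path classes `T y` that are compatible with the paths of the original
space, every bridge represents a power of `g`, then the fundamental groups of the bridged space
are generated by the conjugates of `g`. -/
theorem exists_forall_mem_zpowers_conj {z₀ : Bridged s t}
    (T : ∀ y, Path.Homotopic.Quotient z₀ (incl s t y)) (g : FundamentalGroup (Bridged s t) z₀)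
    (hincl : ∀ {y y' : Y} (p : Path y y'),
      (T y).trans (Path.Homotopic.Quotient.mk (p.map continuous_incl)) = T y')
    (harc : ∀ j, ∃ n : ℤ, (T (s j)).trans (Path.Homotopic.Quotient.mk (arcPath s t j)) =
      Path.Homotopic.Quotient.trans (g ^ n : FundamentalGroup (Bridged s t) z₀) (T (t j)))
    (z : Bridged s t) :
    ∃ c : FundamentalGroupoid.mk z₀ ≅ FundamentalGroupoid.mk z,
      ∀ x : FundamentalGroup (Bridged s t) z, x ∈ Subgroup.zpowers (c.conj g) := by
  obtain ⟨C, hC, hC'⟩ := exists_extend_classes T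
  -- `P q` says that `q`, closed up to a loop at `z₀` by `C a` and `C b`, is a power of `g`.
  let P : ∀ {a b : Bridged s t}, Path.Homotopic.Quotient a b → Prop := fun {a b} q =>
    ∃ n : ℤ, (FundamentalGroupoid.fromPath (C a) ≫ FundamentalGroupoid.fromPath q) =
      (g ^ n : FundamentalGroup (Bridged s t) z₀) ≫ FundamentalGroupoid.fromPath (C b)
  have hP : ∀ {a b : Bridged s t} (q : Path.Homotopic.Quotient a b), P q := by
    have hrefl : ∀ a : Bridged s t, P (Path.Homotopic.Quotient.mk (Path.refl a)) := fun a =>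
      ⟨0, (Category.comp_id (FundamentalGroupoid.fromPath (C a))).trans
        (Category.id_comp (FundamentalGroupoid.fromPath (C a))).symm⟩
    have htrans : ∀ {a b c : Bridged s t} (p : Path.Homotopic.Quotient a b)
        (q : Path.Homotopic.Quotient b c), P p → P q → P (p.trans q) := by
      rintro a b c p q ⟨m, hm⟩ ⟨n, hn⟩
      -- Multiplication in `End` reverses composition, hence the order `n + m`.
      refine ⟨n + m, ?_⟩
      rw [zpow_add, End.mul_def, Category.assoc, ← hn, ← Category.assoc, ← hm, Category.assoc]
      rfl
    have hsymm : ∀ {a b : Bridged s t} (p : Path.Homotopic.Quotient a b), P p → P p.symm := by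
      rintro a b p ⟨m, hm⟩
      refine ⟨-m, ?_⟩
      have h1 : (g ^ (-m) : FundamentalGroup (Bridged s t) z₀) ≫
          (g ^ m : FundamentalGroup (Bridged s t) z₀) = 𝟙 _ := by
        rw [← End.mul_def, ← zpow_add, add_neg_cancel, zpow_zero]
        rfl
      have h2 : FundamentalGroupoid.fromPath p ≫ FundamentalGroupoid.fromPath p.symm = 𝟙 _ :=
        Path.Homotopic.Quotient.trans_symm p
      have h3 : FundamentalGroupoid.fromPath (C b) =
          (g ^ (-m) : FundamentalGroup (Bridged s t) z₀) ≫ FundamentalGroupoid.fromPath (C a) ≫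
            FundamentalGroupoid.fromPath p := by
        rw [hm, ← Category.assoc, h1, Category.id_comp]
      rw [h3, Category.assoc, Category.assoc, h2, Category.comp_id]
    have harcTo : ∀ j r, P (Path.Homotopic.Quotient.mk (arcTo s t j r)) := by
      intro j r
      by_cases h0 : r = 0
      · subst h0
        refine prop_of_forall_apply_eq (P := P) (Path.refl (incl s t (s j))) (fun u => ?_) (hrefl _)
        simp [arcTo, arc_zero]
      by_cases h1 : r = 1
      · subst h1
        refine prop_of_forall_apply_eq (P := P) (arcPath s t j) (fun u => ?_) ?_
        · simp [arcTo, arcPath]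
        · obtain ⟨n, hn⟩ := harc j
          exact ⟨n, by rw [hC, hC]; exact hn⟩
      -- In the interior of a bridge, `C` was defined by following this very path.
      refine ⟨0, ?_⟩
      rw [hC, hC' j r ⟨unitInterval.pos_iff_ne_zero.2 h0, unitInterval.lt_one_iff_ne_one.2 h1⟩]
      exact (Category.id_comp (FundamentalGroupoid.fromPath _)).symm
    intro a b q
    refine path_induction (P := P) htrans hsymm ?_ ?_ q
    · intro y y' p
      refine ⟨0, ?_⟩
      rw [hC, hC]
      exact (hincl p).trans (Category.id_comp (FundamentalGroupoid.fromPath _)).symm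
    · intro j r r' p
      rw [mk_map_arc]
      exact htrans _ _ (hsymm _ (harcTo j r)) (harcTo j r')
  -- For a loop `x` at `z`, `P x` says that `C z` followed by `x` is `g ^ n` followed by `C z`, so
  -- `x` is conjugate to `g ^ n` by `C z`.
  refine ⟨(Groupoid.isoEquivHom _ _).symm (FundamentalGroupoid.fromPath (C z)), fun x => ?_⟩
  obtain ⟨n, hn⟩ := hP x
  refine ⟨n, ?_⟩
  change _ ^ n = x
  rw [← map_zpow, Iso.conj_apply]
  change Groupoid.inv (FundamentalGroupoid.fromPath (C z)) ≫ _ ≫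
    FundamentalGroupoid.fromPath (C z) = x
  rw [← hn, ← Category.assoc]
  exact (congrArg (· ≫ FundamentalGroupoid.fromPath x) (Groupoid.inv_comp _)).trans
    (Category.id_comp (FundamentalGroupoid.fromPath x))

end Bridged

/-! ### Angle along paths in the circle -/

section Angle

/-- A real representative of a point of the circle. -/
noncomputable def angleRep (a : AddCircle (1 : ℝ)) : ℝ := (QuotientAddGroup.mk_surjective a).choose

theorem coe_angleRep (a : AddCircle (1 : ℝ)) : ((angleRep a : ℝ) : AddCircle (1 : ℝ)) = a :=
  (QuotientAddGroup.mk_surjective a).choose_spec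

/-- The total variation of the angle along a path in the circle, measured in full turns. -/
noncomputable def angle {a b : AddCircle (1 : ℝ)} (q : Path.Homotopic.Quotient a b) : ℝ :=
  ((AddCircle.isCoveringMap_coe (1 : ℝ)).monodromy q ⟨angleRep a, coe_angleRep a⟩ : ℝ) - angleRep a

/-- Any lift becomes the one starting at `angleRep a` after a translation, which does not change the
difference of its end points. -/
theorem angle_mk_of_lift {a b : AddCircle (1 : ℝ)} {q : Path a b} {x y : ℝ} (γ : Path x y)
    (h : ∀ u, (γ u : AddCircle (1 : ℝ)) = q u) :
    angle (Path.Homotopic.Quotient.mk q) = y - x := by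
  have cov := AddCircle.isCoveringMap_coe (1 : ℝ)
  have hx : (x : AddCircle (1 : ℝ)) = a := by simpa using h 0
  let Γ : C(I, ℝ) := ⟨fun u => γ u + (angleRep a - x), by fun_prop⟩
  have hΓ := (cov.eq_liftPath_iff' (γ := (q : C(I, AddCircle (1 : ℝ)))) (e := angleRep a)
    (γ_0 := by simp [coe_angleRep]) (Γ := Γ)).2 ⟨by
      funext u
      simp [Γ, coe_angleRep, hx, h], by simp [Γ]⟩
  have : Γ 1 = y + (angleRep a - x) := by simp [Γ]
  change cov.liftPath _ _ _ 1 - angleRep a = _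
  rw [← hΓ, this]
  ring

theorem exists_real_lift {a b : AddCircle (1 : ℝ)} (q : Path a b) {x : ℝ}
    (hx : (x : AddCircle (1 : ℝ)) = a) :
    ∃ (y : ℝ) (γ : Path x y), ∀ u, (γ u : AddCircle (1 : ℝ)) = q u := by
  obtain ⟨Γ, hΓ, hΓ0⟩ := (AddCircle.isCoveringMap_coe (1 : ℝ)).exists_path_lifts
    (q : C(I, AddCircle (1 : ℝ))) x (by simp [hx])
  exact ⟨Γ 1, ⟨Γ, hΓ0, rfl⟩, fun u => congrFun hΓ u⟩

theorem angle_trans {a b c : AddCircle (1 : ℝ)} (p : Path.Homotopic.Quotient a b)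
    (q : Path.Homotopic.Quotient b c) : angle (p.trans q) = angle p + angle q := by
  induction p using Path.Homotopic.Quotient.ind with
  | mk p =>
  induction q using Path.Homotopic.Quotient.ind with
  | mk q =>
  obtain ⟨y, γ, hγ⟩ := exists_real_lift p (coe_angleRep a)
  obtain ⟨z, δ, hδ⟩ := exists_real_lift q (x := y) (by simpa using hγ 1)
  rw [← Path.Homotopic.Quotient.mk_trans, angle_mk_of_lift γ hγ, angle_mk_of_lift δ hδ,
    angle_mk_of_lift (γ.trans δ)]
  · ring
  · intro u
    simp only [Path.trans_apply]
    split_ifs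
    · exact hγ _
    · exact hδ _

theorem angle_refl (a : AddCircle (1 : ℝ)) : angle (Path.Homotopic.Quotient.refl a) = 0 := by
  have := angle_trans (.refl a) (.refl a)
  rw [Path.Homotopic.Quotient.refl_trans] at this
  linarith

end Angle

/-! ### Winding numbers -/

section Winding

variable {Z : Type*} [TopologicalSpace Z]

/-- The winding of a path class with respect to a map to the circle. -/
noncomputable def winding (f : C(Z, AddCircle (1 : ℝ))) {a b : Z}
    (q : Path.Homotopic.Quotient a b) : ℝ := angle (q.map f)

variable (f : C(Z, AddCircle (1 : ℝ)))

theorem winding_trans {a b c : Z} (p : Path.Homotopic.Quotient a b)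
    (q : Path.Homotopic.Quotient b c) : winding f (p.trans q) = winding f p + winding f q := by
  unfold winding
  rw [← angle_trans]
  exact congrArg angle ((FundamentalGroupoid.map f).map_comp (FundamentalGroupoid.fromPath p)
    (FundamentalGroupoid.fromPath q))

theorem winding_refl (a : Z) : winding f (.refl a) = 0 := angle_refl _

theorem winding_symm {a b : Z} (p : Path.Homotopic.Quotient a b) :
    winding f p.symm = - winding f p := by
  have := winding_trans f p p.symm
  rw [Path.Homotopic.Quotient.trans_symm, winding_refl] at this
  linarith

/-- The winding of loops as a homomorphism. -/
noncomputable def windingHom (z : Z) : FundamentalGroup Z z →* Multiplicative ℝ where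
  toFun q := Multiplicative.ofAdd (winding f q)
  map_one' := congrArg Multiplicative.ofAdd (winding_refl f z)
  map_mul' p q := congrArg Multiplicative.ofAdd ((winding_trans f q p).trans (add_comm _ _))

theorem winding_zpow {z : Z} (q : FundamentalGroup Z z) (n : ℤ) :
    winding f (q ^ n : FundamentalGroup Z z) = n * winding f q := by
  have := congrArg Multiplicative.toAdd (map_zpow (windingHom f z) q n)
  rw [toAdd_zpow, zsmul_eq_mul] at this
  exact this

theorem winding_conj {z z' : Z} (c : FundamentalGroupoid.mk z ≅ FundamentalGroupoid.mk z')
    (q : FundamentalGroup Z z) : winding f (c.conj q : FundamentalGroup Z z') = winding f q := by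
  rw [Iso.conj_apply]
  have h : winding f c.inv + winding f c.hom = 0 :=
    (winding_trans f _ _).symm.trans ((congrArg (winding f) c.inv_hom_id).trans (winding_refl f _))
  have h' : winding f (c.inv ≫ q ≫ c.hom) = winding f c.inv + (winding f q + winding f c.hom) :=
    (winding_trans f _ _).trans (congrArg _ (winding_trans f _ _))
  linarith

theorem winding_comp {W : Type*} [TopologicalSpace W] (p : C(W, Z)) {a b : W}
    (q : Path.Homotopic.Quotient a b) : winding f (q.map p) = winding (f.comp p) q := by
  unfold winding
  rw [Path.Homotopic.Quotient.map_comp]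

/-- A group generated by an element of non-zero winding is infinite cyclic. -/
theorem nonempty_mulEquiv_int {z : Z} {k : FundamentalGroup Z z}
    (hk : ∀ x, x ∈ Subgroup.zpowers k) (hw : winding f k ≠ 0) :
    Nonempty (FundamentalGroup Z z ≃* Multiplicative ℤ) := by
  refine ⟨(MulEquiv.ofBijective (zpowersHom _ k) ⟨?_, ?_⟩).symm⟩
  · rw [injective_iff_map_eq_one]
    intro n hn
    have h := winding_zpow f k n.toAdd
    have h1 : k ^ n.toAdd = 1 := hn
    rw [h1] at h
    have h0 : winding f (1 : FundamentalGroup Z z) = 0 := winding_refl f z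
    rw [h0, eq_comm, mul_eq_zero, or_iff_left hw] at h
    exact Multiplicative.toAdd.injective (by exact_mod_cast h)
  · intro x
    obtain ⟨n, hn⟩ := hk x
    exact ⟨Multiplicative.ofAdd n, hn⟩

end Winding

/-! ### Paths in the original space and compatible path classes -/

section Components

variable {X : Type*} [TopologicalSpace X]

/-- If the path components are simply connected, paths with the same end points are homotopic. -/
theorem homotopic_of_simplyConnected_pathComponents
    (h : ∀ x : X, SimplyConnectedSpace (pathComponent x)) {x y : X} (p q : Path x y) :
    p.Homotopic q := by
  have hmem : ∀ (p : Path x y) (u : I), p u ∈ pathComponent x := fun p u =>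
    ⟨(p.subpath 0 u).cast p.source.symm rfl⟩
  have hy : y ∈ pathComponent x := ⟨p⟩
  let lift : Path x y → Path (⟨x, mem_pathComponent_self x⟩ : pathComponent x) ⟨y, hy⟩ := fun p =>
    ⟨⟨fun u => ⟨p u, hmem p u⟩, by fun_prop⟩, Subtype.ext p.source, Subtype.ext p.target⟩
  have := h x
  exact (SimplyConnectedSpace.paths_homotopic (lift p) (lift q)).map
    ⟨Subtype.val, continuous_subtype_val⟩

theorem joined_or_joined (h_two : Nat.card (ZerothHomotopy X) = 2) {x₀ x₁ : X}
    (h_ne : ¬ Joined x₀ x₁) (x : X) : Joined x₀ x ∨ Joined x₁ x := by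
  obtain ⟨a, b, -, hab⟩ := Nat.card_eq_two_iff.1 h_two
  let π : X → ZerothHomotopy X := fun x => Quotient.mk (pathSetoid X) x
  have hπ : ∀ {x y : X}, π x = π y → Joined x y := fun h => Quotient.exact h
  have hmem : ∀ x : X, π x = a ∨ π x = b := fun x => by
    have : π x ∈ ({a, b} : Set (ZerothHomotopy X)) := hab ▸ mem_univ _
    simpa using this
  rcases hmem x₀ with h0 | h0 <;> rcases hmem x₁ with h1 | h1 <;> rcases hmem x with h | h
  · exact (h_ne (hπ (h0.trans h1.symm))).elim
  · exact (h_ne (hπ (h0.trans h1.symm))).elim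
  · exact .inl (hπ (h0.trans h.symm))
  · exact .inr (hπ (h1.trans h.symm))
  · exact .inr (hπ (h1.trans h.symm))
  · exact .inl (hπ (h0.trans h.symm))
  · exact (h_ne (hπ (h0.trans h1.symm))).elim
  · exact (h_ne (hπ (h0.trans h1.symm))).elim

theorem path_discrete_apply {D : Type*} [TopologicalSpace D] [DiscreteTopology D] {i j : D}
    (p : Path i j) (u : I) : p u = i :=
  (PreconnectedSpace.constant inferInstance p.continuous).trans p.source

/-- A class in a product is determined by its projections, and paths in the discrete factor are
constant. -/
theorem homotopic_prod_discrete {D : Type*} [TopologicalSpace D] [DiscreteTopology D]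
    (hX : ∀ {x y : X} (p q : Path x y), p.Homotopic q) {a b : X × D} (p q : Path a b) :
    p.Homotopic q := by
  have h : (q.map continuous_snd) = (p.map continuous_snd) := by
    ext u
    rw [path_discrete_apply, path_discrete_apply]
  have := Path.Homotopic.Quotient.eq.2 (hX (p.map continuous_fst) (q.map continuous_fst))
  rw [← Path.Homotopic.Quotient.eq, ← Path.Homotopic.prod_projLeft_projRight (.mk p),
    ← Path.Homotopic.prod_projLeft_projRight (.mk q)]
  congr 1
  exact (congrArg Path.Homotopic.Quotient.mk h).symm

variable {J V : Type*} {s t : J → X}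

/-- Path classes to representatives of the path components extend to path classes to all points,
compatibly with the paths of the space. -/
theorem exists_compatible_classes (hX : ∀ {x y : X} (p q : Path x y), p.Homotopic q)
    (rep : V → X) (hcov : ∀ x, ∃ v, Joined (rep v) x)
    (hinj : ∀ v v', Joined (rep v) (rep v') → v = v') {z₀ : Bridged s t}
    (S : ∀ v, Path.Homotopic.Quotient z₀ (Bridged.incl s t (rep v))) :
    ∃ T : ∀ x, Path.Homotopic.Quotient z₀ (Bridged.incl s t x), (∀ v, T (rep v) = S v) ∧
      ∀ {x y : X} (p : Path x y),
        (T x).trans (Path.Homotopic.Quotient.mk (p.map Bridged.continuous_incl)) = T y := by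
  choose v hv using hcov
  let γ : ∀ x, Path (rep (v x)) x := fun x => (hv x).some
  -- Uniqueness of representatives forces `w = w'`, and then the two routes to `y` are homotopic. It
  -- gives both compatibility with paths and agreement with `S`.
  have key : ∀ (w w' : V) {x y : X} (p : Path (rep w) x) (q : Path x y) (p' : Path (rep w') y),
      ((S w).trans (.mk (p.map Bridged.continuous_incl))).trans
        (.mk (q.map Bridged.continuous_incl)) =
      (S w').trans (.mk (p'.map Bridged.continuous_incl)) := by
    intro w w' x y p q p'
    obtain rfl := hinj w w' ⟨(p.trans q).trans p'.symm⟩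
    rw [Path.Homotopic.Quotient.trans_assoc, ← Path.Homotopic.Quotient.mk_trans,
      ← Path.map_trans]
    congr 1
    exact Path.Homotopic.Quotient.eq.2 ((hX (p.trans q) p').map ⟨_, Bridged.continuous_incl⟩)
  refine ⟨fun x => (S (v x)).trans (.mk ((γ x).map Bridged.continuous_incl)), fun w => ?_,
    fun p => key _ _ _ _ _⟩
  have := key (v (rep w)) w (γ (rep w)) (Path.refl _) (Path.refl _)
  have hr : Path.Homotopic.Quotient.mk ((Path.refl (rep w)).map
      (Bridged.continuous_incl (s := s) (t := t))) = .refl _ := rfl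
  rwa [hr, Path.Homotopic.Quotient.trans_refl, Path.Homotopic.Quotient.trans_refl] at this

end Components

/-! ### Generators for the base and the cover -/

section Base

variable {X : Type*} [TopologicalSpace X] {x₀ x₁ : X}

/-- The map to the circle that winds the first bridge around the circle and is constant on
the rest. -/
noncomputable def toCircle (x₀ x₁ : X) : C(X2 x₀ x₁, AddCircle (1 : ℝ)) where
  toFun := Bridged.desc (fun _ => 0)
    (fun j r => match j with
      | .A => ((r : ℝ) : AddCircle (1 : ℝ))
      | .B => 0)
    (by rintro (_ | _) <;> simp)
    (by rintro (_ | _) <;> simp)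
  continuous_toFun := by
    refine Bridged.continuous_desc continuous_const ?_
    rintro (_ | _)
    · exact (AddCircle.continuous_mk' 1).comp continuous_subtype_val
    · exact continuous_const

/-- The representatives of the path components. -/
def basePoint (x₀ x₁ : X) : Bool → X
  | false => x₀
  | true => x₁

theorem exists_generator_X2 (hX : ∀ {x y : X} (p q : Path x y), p.Homotopic q)
    (hcov : ∀ x, Joined x₀ x ∨ Joined x₁ x) (h_ne : ¬ Joined x₀ x₁) (b : X2 x₀ x₁) :
    ∃ k : FundamentalGroup (X2 x₀ x₁) b, (∀ x, x ∈ Subgroup.zpowers k) ∧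
      winding (toCircle x₀ x₁) k = 1 := by
  let i : X → X2 x₀ x₁ := Bridged.incl _ _
  let α : Path.Homotopic.Quotient (i x₀) (i x₁) := .mk (Bridged.arcPath _ _ BaseBridge.A)
  let β : Path.Homotopic.Quotient (i x₀) (i x₁) := .mk (Bridged.arcPath _ _ BaseBridge.B)
  have hα : winding (toCircle x₀ x₁) α = 1 :=
    (angle_mk_of_lift (x := 0) (y := 1) ⟨⟨fun u => (u : ℝ), continuous_subtype_val⟩, rfl, rfl⟩
      fun u => rfl).trans (sub_zero 1)
  have hβ : winding (toCircle x₀ x₁) β = 0 :=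
    (angle_mk_of_lift (Path.refl (0 : ℝ)) fun u => rfl).trans (sub_zero 0)
  -- The spanning tree is B, so B has exponent 0 and A represents the loop `α.trans β.symm`.
  let S : ∀ v, Path.Homotopic.Quotient (i x₀) (i (basePoint x₀ x₁ v))
    | false => .refl _
    | true => β
  obtain ⟨T, hT, hT'⟩ := exists_compatible_classes hX (basePoint x₀ x₁)
    (fun x => (hcov x).elim (fun h => ⟨false, h⟩) fun h => ⟨true, h⟩)
    (by
      rintro (_ | _) (_ | _) h
      · rfl
      · exact (h_ne h).elim
      · exact (h_ne h.symm).elim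
      · rfl) S
  have hT₀ : T x₀ = .refl _ := hT false
  have hT₁ : T x₁ = β := hT true
  let g : FundamentalGroup (X2 x₀ x₁) (i x₀) := α.trans β.symm
  have hg : winding (toCircle x₀ x₁) g = 1 := by
    refine (winding_trans _ _ _).trans ?_
    rw [winding_symm, hα, hβ]
    norm_num
  obtain ⟨c, hc⟩ := Bridged.exists_forall_mem_zpowers_conj T g hT' (by
    rintro (_ | _)
    · refine ⟨1, ?_⟩
      rw [zpow_one, hT₀, hT₁]
      change (Path.Homotopic.Quotient.refl (i x₀)).trans α = (α.trans β.symm).trans β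
      simp
    · refine ⟨0, ?_⟩
      rw [zpow_zero, hT₀, hT₁]
      rfl) b
  exact ⟨c.conj g, hc, (winding_conj _ _ _).trans hg⟩

/-- The representatives of the path components of the product with a discrete space. -/
def coverPoint (x₀ x₁ : X) (v : Bool × Fin 2) : X × Fin 2 := (basePoint x₀ x₁ v.1, v.2)

theorem exists_generator_X2Cover (hX : ∀ {x y : X} (p q : Path x y), p.Homotopic q)
    (hcov : ∀ x, Joined x₀ x ∨ Joined x₁ x) (h_ne : ¬ Joined x₀ x₁) (e : X2Cover x₀ x₁) :
    ∃ k : FundamentalGroup (X2Cover x₀ x₁) e, (∀ x, x ∈ Subgroup.zpowers k) ∧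
      winding ((toCircle x₀ x₁).comp (p1 x₀ x₁)) k = 2 := by
  let f := (toCircle x₀ x₁).comp (p1 x₀ x₁)
  let i : X × Fin 2 → X2Cover x₀ x₁ := Bridged.incl _ _
  let α₀ : Path.Homotopic.Quotient (i (x₀, 0)) (i (x₁, 1)) :=
    .mk (Bridged.arcPath _ _ CoverBridge.A₀)
  let α₁ : Path.Homotopic.Quotient (i (x₀, 1)) (i (x₁, 0)) :=
    .mk (Bridged.arcPath _ _ CoverBridge.A₁)
  let β₀ : Path.Homotopic.Quotient (i (x₀, 0)) (i (x₁, 0)) :=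
    .mk (Bridged.arcPath _ _ CoverBridge.B₀)
  let β₁ : Path.Homotopic.Quotient (i (x₀, 1)) (i (x₁, 1)) :=
    .mk (Bridged.arcPath _ _ CoverBridge.B₁)
  let γ : Path (0 : ℝ) 1 := ⟨⟨fun u => (u : ℝ), continuous_subtype_val⟩, rfl, rfl⟩
  have hα₀ : winding f α₀ = 1 := (angle_mk_of_lift γ fun u => rfl).trans (sub_zero 1)
  have hα₁ : winding f α₁ = 1 := (angle_mk_of_lift γ fun u => rfl).trans (sub_zero 1)
  have hβ₀ : winding f β₀ = 0 :=
    (angle_mk_of_lift (Path.refl (0 : ℝ)) fun u => rfl).trans (sub_zero 0)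
  have hβ₁ : winding f β₁ = 0 :=
    (angle_mk_of_lift (Path.refl (0 : ℝ)) fun u => rfl).trans (sub_zero 0)
  -- The spanning tree is the chain B₀, A₁ reversed, B₁ through the four vertices. Only A₀ is left,
  -- and it closes the 4-cycle; A₀ and A₁ are then run in the same direction, which gives winding 1
  -- + 1.
  let S : ∀ v, Path.Homotopic.Quotient (i (x₀, 0)) (i (coverPoint x₀ x₁ v))
    | (false, 0) => .refl _
    | (true, 0) => β₀
    | (false, 1) => β₀.trans α₁.symm
    | (true, 1) => (β₀.trans α₁.symm).trans β₁
  obtain ⟨T, hT, hT'⟩ := exists_compatible_classes (homotopic_prod_discrete hX)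
    (coverPoint x₀ x₁)
    (fun x => (hcov x.1).elim
      (fun h => ⟨(false, x.2), ⟨h.some.prod (Path.refl x.2)⟩⟩)
      fun h => ⟨(true, x.2), ⟨h.some.prod (Path.refl x.2)⟩⟩)
    (by
      rintro ⟨v, i⟩ ⟨v', i'⟩ ⟨p⟩
      have h2 : i' = i := by
        have := path_discrete_apply (p.map continuous_snd) 1
        rwa [Path.target] at this
      have h1 : Joined (basePoint x₀ x₁ v) (basePoint x₀ x₁ v') := ⟨p.map continuous_fst⟩
      subst h2
      cases v <;> cases v'
      · rfl
      · exact (h_ne h1).elim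
      · exact (h_ne h1.symm).elim
      · rfl) S
  have hT₀₀ : T (x₀, 0) = .refl _ := hT (false, 0)
  have hT₁₀ : T (x₁, 0) = β₀ := hT (true, 0)
  have hT₀₁ : T (x₀, 1) = β₀.trans α₁.symm := hT (false, 1)
  have hT₁₁ : T (x₁, 1) = (β₀.trans α₁.symm).trans β₁ := hT (true, 1)
  let g : FundamentalGroup (X2Cover x₀ x₁) (i (x₀, 0)) :=
    α₀.trans ((β₀.trans α₁.symm).trans β₁).symm
  have hg : winding f g = 2 := by
    refine (winding_trans _ _ _).trans ?_
    rw [winding_symm, winding_trans, winding_trans, winding_symm, hα₀, hα₁, hβ₀, hβ₁]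
    norm_num
  obtain ⟨c, hc⟩ := Bridged.exists_forall_mem_zpowers_conj T g hT' (by
    rintro (_ | _ | _ | _)
    · refine ⟨1, ?_⟩
      change (T (x₀, 0)).trans α₀ = Path.Homotopic.Quotient.trans _ (T (x₁, 1))
      rw [zpow_one, hT₀₀, hT₁₁]
      change (Path.Homotopic.Quotient.refl (i (x₀, 0))).trans α₀ =
        (α₀.trans ((β₀.trans α₁.symm).trans β₁).symm).trans ((β₀.trans α₁.symm).trans β₁)
      rw [Path.Homotopic.Quotient.trans_assoc α₀, Path.Homotopic.Quotient.symm_trans,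
        Path.Homotopic.Quotient.trans_refl, Path.Homotopic.Quotient.refl_trans]
    · refine ⟨0, ?_⟩
      change (T (x₀, 1)).trans α₁ = Path.Homotopic.Quotient.trans _ (T (x₁, 0))
      rw [zpow_zero, hT₀₁, hT₁₀, Path.Homotopic.Quotient.trans_assoc,
        Path.Homotopic.Quotient.symm_trans, Path.Homotopic.Quotient.trans_refl]
      exact (Path.Homotopic.Quotient.refl_trans _).symm
    · refine ⟨0, ?_⟩
      change (T (x₀, 0)).trans β₀ = Path.Homotopic.Quotient.trans _ (T (x₁, 0))
      rw [zpow_zero, hT₀₀, hT₁₀]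
      rfl
    · refine ⟨0, ?_⟩
      change (T (x₀, 1)).trans β₁ = Path.Homotopic.Quotient.trans _ (T (x₁, 1))
      rw [zpow_zero, hT₀₁, hT₁₁]
      exact (Path.Homotopic.Quotient.refl_trans _).symm) e
  exact ⟨c.conj g, hc, (winding_conj _ _ _).trans hg⟩

end Base

/-- Every isomorphism of a cyclic group with `ℤ` sends the square of a generator to a generator
of `2ℤ`. -/
theorem map_zpowers_sq {G : Type*} [Group G] {k : G} (hk : ∀ x, x ∈ Subgroup.zpowers k)
    (φ : G ≃* Multiplicative ℤ) :
    (Subgroup.zpowers (k ^ 2)).map φ.toMonoidHom =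
      Subgroup.zpowers (Multiplicative.ofAdd (2 : ℤ)) := by
  obtain ⟨n, hn⟩ := hk (φ.symm (Multiplicative.ofAdd 1))
  -- The generator `k` must go to a unit of `ℤ`; for either sign its square generates the same
  -- subgroup.
  have h : n * (φ k).toAdd = 1 := by
    have := congrArg (fun x => (φ x).toAdd) hn
    simpa using this
  have hu : (φ k).toAdd = 1 ∨ (φ k).toAdd = -1 :=
    Int.isUnit_iff.1 (IsUnit.of_mul_eq_one_right _ h)
  rw [MonoidHom.map_zpowers]
  rcases hu with hu | hu
  · have : φ.toMonoidHom (k ^ 2) = Multiplicative.ofAdd (2 : ℤ) :=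
      Multiplicative.toAdd.injective (by simp [hu])
    rw [this]
  · have : φ.toMonoidHom (k ^ 2) = (Multiplicative.ofAdd (2 : ℤ))⁻¹ :=
      Multiplicative.toAdd.injective (by simp [hu])
    rw [this, Subgroup.zpowers_inv]

end AnomalousCover

open AnomalousCover in
theorem mainTheorem4 {X : Type*} [TopologicalSpace X] [ConnectedSpace X]
    (h_two : Nat.card (ZerothHomotopy X) = 2)
    (h_sc : ∀ x : X, SimplyConnectedSpace (pathComponent x))
    (h_lpc : ∀ x : X, LocallyPathConnectedSpace (pathComponent x))
    (x₀ x₁ : X) (h_ne : ¬ Joined x₀ x₁) :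
    (∀ b : X2 x₀ x₁, Nonempty (FundamentalGroup (X2 x₀ x₁) b ≃* Multiplicative ℤ)) ∧
    (∀ e : X2Cover x₀ x₁, Nonempty (FundamentalGroup (X2Cover x₀ x₁) e ≃* Multiplicative ℤ)) ∧
    (∀ (e : X2Cover x₀ x₁)
      (φ : FundamentalGroup (X2 x₀ x₁) (p1 x₀ x₁ e) ≃* Multiplicative ℤ),
      (FundamentalGroup.map (p1 x₀ x₁) e).range.map φ.toMonoidHom =
        Subgroup.zpowers (Multiplicative.ofAdd (2 : ℤ))) := by
  have hX := fun {x y : X} (p q : Path x y) =>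
    homotopic_of_simplyConnected_pathComponents h_sc p q
  have hcov := joined_or_joined h_two h_ne
  refine ⟨fun b => ?_, fun e => ?_, fun e φ => ?_⟩
  · obtain ⟨k, hk, hw⟩ := exists_generator_X2 hX hcov h_ne b
    exact nonempty_mulEquiv_int _ hk (hw ▸ one_ne_zero)
  · obtain ⟨k, hk, hw⟩ := exists_generator_X2Cover hX hcov h_ne e
    exact nonempty_mulEquiv_int _ hk (hw ▸ two_ne_zero)
  · obtain ⟨k, hk, hw⟩ := exists_generator_X2 hX hcov h_ne (p1 x₀ x₁ e)
    obtain ⟨l, hl, hwl⟩ := exists_generator_X2Cover hX hcov h_ne e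
    have hw2 : winding (toCircle x₀ x₁) (FundamentalGroup.map (p1 x₀ x₁) e l) = 2 :=
      (winding_comp _ _ _).trans hwl
    -- The image of `l` is some power of `k`, and the winding number identifies the exponent.
    obtain ⟨n, hn⟩ := hk (FundamentalGroup.map (p1 x₀ x₁) e l)
    have hn2 : n = 2 := by
      have h := winding_zpow (toCircle x₀ x₁) k n
      have hn' : k ^ n = FundamentalGroup.map (p1 x₀ x₁) e l := hn
      rw [hn', hw2, hw, mul_one] at h
      exact_mod_cast h.symm
    have hrange : (FundamentalGroup.map (p1 x₀ x₁) e).range = Subgroup.zpowers (k ^ 2) := by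
      have htop : Subgroup.zpowers l = ⊤ := (Subgroup.eq_top_iff' _).2 hl
      have hkl : k ^ 2 = FundamentalGroup.map (p1 x₀ x₁) e l := by
        rw [← hn, hn2]
        exact (zpow_ofNat k 2).symm
      rw [hkl, ← MonoidHom.map_zpowers, htop, MonoidHom.range_eq_map]
    rw [hrange]
    exact map_zpowers_sq hk φ
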